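/- Throughout, $N,K,n$ are natural numbers. A family $P=(P(a,b|x,y))_{x,y\in[N],\,a,b\in[K]}$ of real numbers is called \emph{classical} if $P(a,b|x,y)=\int_\Omega P_\omega(a|x)Q_\omega(b|y)\,d\mathbb P(\omega)$ for some probability space $(\Omega,\Sigma,\mathbb P)$ and functions, measurable in $\omega$, with $P_\omega(a|x),Q_\omega(b|y)\ge 0$ and $\sum_a P_\omega(a|x)=\sum_b Q_\omega(b|y)=1$ for all $\omega,x,y$. For a state $\rho$ on $\mathbb C^n\otimes\mathbb C^n$, $P$ is \emph{quantum with state $\rho$} if $P(a,b|x,y)=\operatorname{tr}\big((E_x^a\otimes F_y^b)\rho\big)$ for some positive semidefinite operators $E_x^a,F_y^b$ on $\mathbb C^n$ with $\sum_aE_x^a=\sum_bF_y^b=1$ for all $x,y$. For real coefficients $M=(M_{x,y}^{a,b})$ put $\langle M,P\rangle=\sum_{x,y,a,b}M_{x,y}^{a,b}P(a,b|x,y)$, $\omega(M)=\sup\{|\langle M,P\rangle| : P \text{ classical}\}$ and $\omega^*_\rho(M)=\sup\{|\langle M,Q\rangle| : Q\text{ quantum with state }\rho\}$, and define the largest Bell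 violation of $\rho$ by $$LV_\rho=\sup_{N,K}\ \sup_{M}\ \frac{\omega^*_\rho(M)}{\omega(M)}\in[0,\infty],$$ where $M$ ranges over the families that do not vanish on all classical $P$. For a unit vector $|\varphi\rangle$ write $LV_{|\varphi\rangle}=LV_{|\varphi\rangle\langle\varphi|}$. \textbf{Theorem.} There is a universal constant $C>0$ such that for every $n$ and every pure state $|\varphi\rangle=\sum_{i=1}^n\alpha_i|ii\rangle\in\mathbb C^n\otimes\mathbb C^n$, where $(\alpha_i)_{i=1}^n$ is a non-increasing sequence of positive real numbers with $\sum_{i=1}^n\alpha_i^2=1$, $$LV_{|\varphi\rangle}\ \ge\ C\,\sup_{2\le k\le n}\Big(\frac{\sum_{i=1}^k\alpha_i}{\log k}\Big)^2,$$ where $\log$ is the natural logarithm (for $n=1$ the supremum is over the empty set and is read as $0$). -/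

import Mathlib

open scoped Kronecker ENNReal ComplexOrder

namespace BellViolation

/-- Families of real numbers `T x y a b` indexed by two questions `x, y ∈ [N]` and two answers
`a, b ∈ [K]`; both the coefficients `M_{x,y}^{a,b}` of a Bell functional and the probabilities
`P(a,b|x,y)` are of this kind. -/
abbrev Table (N K : ℕ) : Type := Fin N → Fin N → Fin K → Fin K → ℝ

/-- The pairing `⟨M, P⟩ = ∑_{x,y;a,b} M_{x,y}^{a,b} P(a,b|x,y)`. -/
def pairing {N K : ℕ} (M P : Table N K) : ℝ :=
  ∑ x, ∑ y, ∑ a, ∑ b, M x y a b * P x y a b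

/-- Classical (local hidden variable) distributions:
`P(a,b|x,y) = ∫ P_ω(a|x) Q_ω(b|y) dℙ(ω)` over a probability space, where for every `ω` the
`P_ω(·|x)` and `Q_ω(·|y)` are probability distributions on the answers, measurable in `ω`. -/
def IsClassical {N K : ℕ} (P : Table N K) : Prop :=
  ∃ (Ω : Type) (_ : MeasurableSpace Ω) (μ : MeasureTheory.Measure Ω)
    (p q : Ω → Fin N → Fin K → ℝ),
    MeasureTheory.IsProbabilityMeasure μ ∧
    (∀ x a, Measurable fun ω => p ω x a) ∧
    (∀ y b, Measurable fun ω => q ω y b) ∧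
    (∀ ω x a, 0 ≤ p ω x a) ∧ (∀ ω x, ∑ a, p ω x a = 1) ∧
    (∀ ω y b, 0 ≤ q ω y b) ∧ (∀ ω y, ∑ b, q ω y b = 1) ∧
    ∀ x y a b, P x y a b = ∫ ω, p ω x a * q ω y b ∂μ

/-- For each question `x ∈ [N]`, a POVM `(E x a)_{a ∈ [K]}` on `ℂⁿ`. -/
def IsPOVMFamily {n N K : ℕ} (E : Fin N → Fin K → Matrix (Fin n) (Fin n) ℂ) : Prop :=
  (∀ x a, (E x a).PosSemidef) ∧ ∀ x, ∑ a, E x a = 1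

/-- Quantum distributions built from the bipartite operator `ρ` on `ℂⁿ ⊗ ℂⁿ`:
`P(a,b|x,y) = tr((E_x^a ⊗ F_y^b) ρ)` for POVMs `E`, `F` on `ℂⁿ`. -/
def IsQuantum {n N K : ℕ} (ρ : Matrix (Fin n × Fin n) (Fin n × Fin n) ℂ)
    (P : Table N K) : Prop :=
  ∃ E F : Fin N → Fin K → Matrix (Fin n) (Fin n) ℂ,
    IsPOVMFamily E ∧ IsPOVMFamily F ∧
    ∀ x y a b, (P x y a b : ℂ) = ((E x a ⊗ₖ F y b) * ρ).trace

/-- The set `𝓜^{N,K}` of Bell inequalities: those `M` that do not vanish on all classical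
distributions. -/
def IsBellInequality {N K : ℕ} (M : Table N K) : Prop :=
  ∃ P : Table N K, IsClassical P ∧ pairing M P ≠ 0

/-- The classical value `ω(M) = sup {|⟨M, P⟩| : P classical}`. -/
noncomputable def classicalValue {N K : ℕ} (M : Table N K) : ℝ≥0∞ :=
  ⨆ (P : Table N K) (_ : IsClassical P), ENNReal.ofReal |pairing M P|

/-- The quantum value with state `ρ`, `ω*_ρ(M) = sup {|⟨M, Q⟩| : Q quantum with state ρ}`. -/
noncomputable def quantumValue {n N K : ℕ} (ρ : Matrix (Fin n × Fin n) (Fin n × Fin n) ℂ)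
    (M : Table N K) : ℝ≥0∞ :=
  ⨆ (Q : Table N K) (_ : IsQuantum ρ Q), ENNReal.ofReal |pairing M Q|

/-- The largest Bell violation `LV_ρ = sup_{N,K} sup_{M ∈ 𝓜^{N,K}} ω*_ρ(M) / ω(M)` of `ρ`.
The denominator is positive and finite for every Bell inequality `M`. -/
noncomputable def largestViolation {n : ℕ}
    (ρ : Matrix (Fin n × Fin n) (Fin n × Fin n) ℂ) : ℝ≥0∞ :=
  ⨆ (N : ℕ) (K : ℕ) (M : Table N K) (_ : IsBellInequality M),
    quantumValue ρ M / classicalValue M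

/-- The vector `∑ᵢ αᵢ |ii⟩` of `ℂⁿ ⊗ ℂⁿ`. -/
def diagonalVector {n : ℕ} (α : Fin n → ℝ) : Fin n × Fin n → ℂ :=
  fun p => if p.1 = p.2 then (α p.1 : ℂ) else 0

/-- The operator `|φ⟩⟨φ|`. -/
def pureState {n : ℕ} (φ : Fin n × Fin n → ℂ) : Matrix (Fin n × Fin n) (Fin n × Fin n) ℂ :=
  Matrix.vecMulVec φ (star φ)

end BellViolation

namespace BellViolation

/-! The violation comes from a Khot–Vishnoi type functional on the cube `{±1}^k`, with `k` a power
of two. Questions are all points `x`; answer `a` names the point `x * h a`, where the `h a` are the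
rows of a Hadamard matrix; the coefficient is the noise kernel of correlation `ρ = r²` between the
two named points.

Classically, a product strategy yields densities `F`, `G` on the cube of mean 1 with values in `[0,
k]`, and its value is `∑ (T_r F)(T_r G)`. Hypercontractivity with `r² = 1/(2m)`, `k ≤ e^m`, bounds
this by `2^k e` (`sum_noise_sq_le`, `classicalValue_bellTable_le`).

In the quantum case, the rank-one effects along the sign vectors of the named points, completed on
the coordinates beyond `k`, give probability at least `k⁻² (∑ αᵢ uᵢ vᵢ)²`. The mean of `uᵢ vᵢ` under
the noise is `ρ`, so Jensen gives value at least `2^k (ρ ∑ αᵢ)²` (`le_quantumValue_bellTable`). With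
`m = ⌈log k⌉` the quotient has the required order; rounding `k` down to a power of two costs a
factor 2 in the sum. -/

/-! ### Two-point and Minkowski inequalities -/

lemma choose_two_mul_le (m j : ℕ) :
    ((2 * m).choose (2 * j) : ℝ) ≤ (2 * m : ℝ) ^ j * (m.choose j : ℝ) := by
  induction j with
  | zero => simp
  | succ j ih =>
    rcases lt_or_ge m (j + 1) with hm | hm
    · rw [Nat.choose_eq_zero_of_lt (by omega : 2 * m < 2 * (j + 1)),
        Nat.choose_eq_zero_of_lt hm]
      simp
    · obtain ⟨t, rfl⟩ := Nat.exists_eq_add_of_le hm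
      have h1 := Nat.choose_succ_right_eq (2 * (j + 1 + t)) (2 * j)
      have h2 := Nat.choose_succ_right_eq (2 * (j + 1 + t)) (2 * j + 1)
      have h3 := Nat.choose_succ_right_eq (j + 1 + t) j
      rw [show 2 * (j + 1 + t) - 2 * j = 2 * t + 2 by omega] at h1
      rw [show 2 * (j + 1 + t) - (2 * j + 1) = 2 * t + 1 by omega] at h2
      rw [show j + 1 + t - j = t + 1 by omega] at h3
      have h1' : ((2 * (j + 1 + t)).choose (2 * j + 1) : ℝ) * (2 * j + 1) =
          (2 * (j + 1 + t)).choose (2 * j) * (2 * t + 2) := by exact_mod_cast h1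
      have h2' : ((2 * (j + 1 + t)).choose (2 * (j + 1)) : ℝ) * (2 * j + 2) =
          (2 * (j + 1 + t)).choose (2 * j + 1) * (2 * t + 1) := by exact_mod_cast h2
      have h3' : ((j + 1 + t).choose (j + 1) : ℝ) * (j + 1) =
          (j + 1 + t).choose j * (t + 1) := by exact_mod_cast h3
      push_cast at ih h1' h2' h3' ⊢
      set X := ((2 * (j + 1 + t)).choose (2 * j) : ℝ)
      set Y := ((2 * (j + 1 + t)).choose (2 * j + 1) : ℝ)
      set Z := ((2 * (j + 1 + t)).choose (2 * (j + 1)) : ℝ)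
      set U := ((j + 1 + t).choose j : ℝ)
      set V := ((j + 1 + t).choose (j + 1) : ℝ)
      set p := (2 * ((j : ℝ) + 1 + t)) ^ j with hp
      have hp0 : 0 ≤ p := by positivity
      have hV0 : 0 ≤ V := by positivity
      -- Passing from `j` to `j + 1`, the quotient of the two binomials grows by `(2t+1)/(2j+1)`,
      -- which is at most `2(j+1+t)`.
      have key : Z * ((2 * j + 1) * (j + 1)) ≤
          p * (2 * ((j : ℝ) + 1 + t)) * V * ((2 * j + 1) * (j + 1)) := by
        calc Z * ((2 * j + 1) * (j + 1)) = X * ((t + 1) * (2 * t + 1)) := by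
              linear_combination (2 * (j : ℝ) + 1) / 2 * h2' + (2 * (t : ℝ) + 1) / 2 * h1'
          _ ≤ p * U * ((t + 1) * (2 * t + 1)) := by gcongr
          _ = p * V * (2 * t + 1) * (j + 1) := by
              linear_combination (- p * (2 * (t : ℝ) + 1)) * h3'
          _ ≤ p * V * ((2 * ((j : ℝ) + 1 + t)) * (2 * j + 1)) * (j + 1) := by
              gcongr
              have : (0 : ℝ) ≤ j := by positivity
              have : (0 : ℝ) ≤ t := by positivity
              nlinarith [mul_nonneg ‹(0 : ℝ) ≤ j› ‹(0 : ℝ) ≤ t›]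
          _ = _ := by ring
      rw [pow_succ]
      exact le_of_mul_le_mul_right key (by positivity)

lemma sum_range_two_mul_add_one (g : ℕ → ℝ) (m : ℕ) :
    ∑ i ∈ Finset.range (2 * m + 1), g i =
      ∑ j ∈ Finset.range (m + 1), g (2 * j) + ∑ j ∈ Finset.range m, g (2 * j + 1) := by
  induction m with
  | zero => simp
  | succ m ih =>
    rw [show 2 * (m + 1) + 1 = 2 * m + 1 + 1 + 1 by ring, Finset.sum_range_succ,
      Finset.sum_range_succ, ih, Finset.sum_range_succ _ (m + 1), Finset.sum_range_succ (fun j => g (2 * j + 1)) m]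
    rw [show 2 * (m + 1) = 2 * m + 1 + 1 by ring]
    ring

/-- The two-point hypercontractive inequality for even exponents. -/
lemma two_point_inequality {m : ℕ} {r : ℝ} (hr : r ^ 2 * (2 * m) ≤ 1) (a b : ℝ) :
    (a + r * b) ^ (2 * m) + (a - r * b) ^ (2 * m) ≤ 2 * (a ^ 2 + b ^ 2) ^ m := by
  -- Odd powers of `b` cancel; the even ones are compared term by term with the expansion of `(a² +
  -- b²)^m`.
  have h1 : (a + r * b) ^ (2 * m) + (a - r * b) ^ (2 * m) =
      2 * ∑ j ∈ Finset.range (m + 1),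
        (r * b) ^ (2 * j) * a ^ (2 * m - 2 * j) * ((2 * m).choose (2 * j) : ℝ) := by
    rw [show a + r * b = r * b + a by ring, show a - r * b = -(r * b) + a by ring, add_pow,
      add_pow, sum_range_two_mul_add_one, sum_range_two_mul_add_one]
    have e1 : ∀ j, (-(r * b)) ^ (2 * j) = (r * b) ^ (2 * j) := fun j =>
      Even.neg_pow (even_two_mul j) _
    have e2 : ∀ j, (-(r * b)) ^ (2 * j + 1) = -(r * b) ^ (2 * j + 1) := fun j =>
      Odd.neg_pow (odd_two_mul_add_one j) _
    simp only [e1, e2, neg_mul, Finset.sum_neg_distrib]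
    ring
  rw [h1, add_comm (a ^ 2), add_pow]
  refine mul_le_mul_of_nonneg_left (Finset.sum_le_sum fun j hj => ?_) zero_le_two
  have hj' : j ≤ m := by simpa [Nat.lt_succ_iff] using hj
  have e : a ^ (2 * m - 2 * j) = (a ^ 2) ^ (m - j) := by
    rw [← pow_mul, Nat.mul_sub]
  rw [e, mul_pow, pow_mul, pow_mul]
  have h3 : (r ^ 2) ^ j * ((2 * m).choose (2 * j) : ℝ) ≤ m.choose j := by
    calc (r ^ 2) ^ j * ((2 * m).choose (2 * j) : ℝ)
        ≤ (r ^ 2) ^ j * ((2 * m : ℝ) ^ j * (m.choose j : ℝ)) := by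
          gcongr; exact choose_two_mul_le m j
      _ = (r ^ 2 * (2 * m)) ^ j * m.choose j := by rw [mul_pow]; ring
      _ ≤ 1 * m.choose j := by
          gcongr
          exact pow_le_one₀ (by positivity) hr
      _ = _ := one_mul _
  calc (r ^ 2) ^ j * (b ^ 2) ^ j * (a ^ 2) ^ (m - j) * ((2 * m).choose (2 * j) : ℝ)
      = (b ^ 2) ^ j * (a ^ 2) ^ (m - j) * ((r ^ 2) ^ j * ((2 * m).choose (2 * j) : ℝ)) := by ring
    _ ≤ _ := by gcongr

/-- Minkowski's inequality for natural exponents, in terms of bounds on the `m`-th moments. -/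
lemma sum_add_pow_le {ι : Type*} [Fintype ι] {m : ℕ} (hm : 1 ≤ m) {G H : ι → ℝ}
    (hG : ∀ i, 0 ≤ G i) (hH : ∀ i, 0 ≤ H i) {c A B : ℝ} (hc : 0 ≤ c) (hA : 0 ≤ A) (hB : 0 ≤ B)
    (h1 : ∑ i, G i ^ m ≤ c * A ^ m) (h2 : ∑ i, H i ^ m ≤ c * B ^ m) :
    ∑ i, (G i + H i) ^ m ≤ c * (A + B) ^ m := by
  have hm0 : m ≠ 0 := by omega
  have key := Real.Lp_add_le_of_nonneg (s := Finset.univ) (p := (m : ℝ)) (by exact_mod_cast hm)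
    (fun i _ => hG i) (fun i _ => hH i)
  simp only [Real.rpow_natCast, one_div] at key
  have aux : ∀ {S X : ℝ}, 0 ≤ S → 0 ≤ X → S ≤ c * X ^ m →
      S ^ (m : ℝ)⁻¹ ≤ c ^ (m : ℝ)⁻¹ * X := by
    intro S X hS hX h
    calc S ^ (m : ℝ)⁻¹ ≤ (c * X ^ m) ^ (m : ℝ)⁻¹ := Real.rpow_le_rpow hS h (by positivity)
      _ = c ^ (m : ℝ)⁻¹ * X := by
        rw [Real.mul_rpow hc (by positivity), Real.pow_rpow_inv_natCast hX hm0]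
  have hS : 0 ≤ ∑ i, (G i + H i) ^ m :=
    Finset.sum_nonneg fun i _ => pow_nonneg (add_nonneg (hG i) (hH i)) _
  have h := key.trans (add_le_add
    (aux (Finset.sum_nonneg fun i _ => pow_nonneg (hG i) _) hA h1)
    (aux (Finset.sum_nonneg fun i _ => pow_nonneg (hH i) _) hB h2))
  have h' := pow_le_pow_left₀ (by positivity) h m
  rwa [Real.rpow_inv_natCast_pow hS hm0, ← mul_add, mul_pow,
    Real.rpow_inv_natCast_pow hc hm0] at h'

/-! ### The noise operator and hypercontractivity -/

/-- The discrete cube `{±1}^d`. -/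
abbrev Cube (d : ℕ) : Type := Fin d → ℤˣ

/-- The embedding of the signs into the real numbers. -/
def sgn : ℤˣ →* ℝ := (Int.castRingHom ℝ).toMonoidHom.comp (Units.coeHom ℤ)

@[simp] lemma sgn_neg_one : sgn (-1) = -1 := by simp [sgn]

lemma sgn_mul_self (u : ℤˣ) : sgn u * sgn u = 1 := by
  rw [← map_mul, Int.units_mul_self, map_one]

lemma abs_sgn (u : ℤˣ) : |sgn u| = 1 := by
  rcases Int.units_eq_one_or u with rfl | rfl <;> simp

lemma sum_units_int (f : ℤˣ → ℝ) : ∑ u, f u = f 1 + f (-1) := by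
  rw [UnitsInt.univ, Finset.sum_pair (by decide)]

/-- The transition kernel of the noise operator with correlation `r`. -/
noncomputable def noiseKernel {d : ℕ} (r : ℝ) (x y : Cube d) : ℝ :=
  ∏ i, (1 + r * sgn (x i * y i)) / 2

/-- The noise operator `T_r` on functions on the cube. -/
noncomputable def noise {d : ℕ} (r : ℝ) (f : Cube d → ℝ) (x : Cube d) : ℝ :=
  ∑ y, noiseKernel r x y * f y

lemma sum_cube_succ {d : ℕ} (f : Cube (d + 1) → ℝ) :
    ∑ x, f x = ∑ x : Cube d, (f (Fin.cons 1 x) + f (Fin.cons (-1) x)) := by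
  rw [← (Fin.consEquiv fun _ => ℤˣ).sum_comp, Fintype.sum_prod_type, sum_units_int,
    ← Finset.sum_add_distrib]
  rfl

lemma noiseKernel_cons {d : ℕ} (r : ℝ) (s t : ℤˣ) (x y : Cube d) :
    noiseKernel r (Fin.cons s x : Cube (d + 1)) (Fin.cons t y) =
      (1 + r * sgn (s * t)) / 2 * noiseKernel r x y := by
  simp only [noiseKernel, Fin.prod_univ_succ, Fin.cons_zero, Fin.cons_succ]

lemma noise_cons {d : ℕ} (r : ℝ) (f : Cube (d + 1) → ℝ) (s : ℤˣ) (x : Cube d) :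
    noise r f (Fin.cons s x) =
      noise r (fun y => (f (Fin.cons 1 y) + f (Fin.cons (-1) y)) / 2) x +
        r * sgn s * noise r (fun y => (f (Fin.cons 1 y) - f (Fin.cons (-1) y)) / 2) x := by
  simp only [noise, sum_cube_succ, noiseKernel_cons, Finset.mul_sum, ← Finset.sum_add_distrib]
  refine Finset.sum_congr rfl fun y _ => ?_
  simp only [map_mul, map_one, sgn_neg_one]
  ring

/-- The Bonami–Beckner hypercontractive inequality from `L²` to `L^{2m}`. -/
theorem hypercontractivity {m : ℕ} (hm : 1 ≤ m) {r : ℝ} (hr : r ^ 2 * (2 * m) ≤ 1) {d : ℕ}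
    (f : Cube d → ℝ) :
    ∑ x, noise r f x ^ (2 * m) ≤ 2 ^ d * ((∑ x, f x ^ 2) / 2 ^ d) ^ m := by
  induction d with
  | zero => simp [noise, noiseKernel, ← pow_mul]
  | succ d ih =>
    -- Even and odd parts in the first coordinate: `T f (±1, x) = T g x ± r T h x`, to which the
    -- two-point inequality applies pointwise.
    set g : Cube d → ℝ := fun y => (f (Fin.cons 1 y) + f (Fin.cons (-1) y)) / 2
    set h : Cube d → ℝ := fun y => (f (Fin.cons 1 y) - f (Fin.cons (-1) y)) / 2
    have hsum : (∑ x, f x ^ 2) / 2 ^ (d + 1) =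
        (∑ x, g x ^ 2) / 2 ^ d + (∑ x, h x ^ 2) / 2 ^ d := by
      rw [sum_cube_succ, ← add_div, ← Finset.sum_add_distrib, pow_succ, mul_comm ((2 : ℝ) ^ d),
        ← div_div, Finset.sum_div]
      congr 1
      refine Finset.sum_congr rfl fun x _ => ?_
      simp only [g, h]
      ring
    rw [sum_cube_succ, hsum]
    calc ∑ x : Cube d, (noise r f (Fin.cons 1 x) ^ (2 * m) +
            noise r f (Fin.cons (-1) x) ^ (2 * m))
        = ∑ x, ((noise r g x + r * noise r h x) ^ (2 * m) +
            (noise r g x - r * noise r h x) ^ (2 * m)) := by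
          refine Finset.sum_congr rfl fun x _ => ?_
          rw [noise_cons, noise_cons, map_one, sgn_neg_one]
          ring
      _ ≤ ∑ x, 2 * (noise r g x ^ 2 + noise r h x ^ 2) ^ m :=
          Finset.sum_le_sum fun x _ => two_point_inequality hr _ _
      _ = 2 * ∑ x, (noise r g x ^ 2 + noise r h x ^ 2) ^ m := by rw [Finset.mul_sum]
      _ ≤ 2 * (2 ^ d * ((∑ x, g x ^ 2) / 2 ^ d + (∑ x, h x ^ 2) / 2 ^ d) ^ m) := by
          refine mul_le_mul_of_nonneg_left ?_ zero_le_two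
          -- Minkowski in `L^m` for `(T g)²` and `(T h)²`, whose `m`-th moments are bounded by
          -- induction.
          refine sum_add_pow_le hm (fun _ => sq_nonneg _) (fun _ => sq_nonneg _) (by positivity)
            (by positivity) (by positivity) ?_ ?_
          · simpa only [← pow_mul] using ih g
          · simpa only [← pow_mul] using ih h
      _ = _ := by ring

/-! ### Semigroup, symmetry and eigenvector properties of the noise -/

lemma sum_prod_cube {d : ℕ} (f : Fin d → ℤˣ → ℝ) :
    ∑ x : Cube d, ∏ i, f i (x i) = ∏ i, (f i 1 + f i (-1)) := by
  simp only [← sum_units_int, Finset.prod_univ_sum, Fintype.piFinset_univ]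

lemma noiseKernel_comm {d : ℕ} (r : ℝ) (x y : Cube d) :
    noiseKernel r x y = noiseKernel r y x := by
  simp only [noiseKernel, mul_comm]

lemma noiseKernel_pos {d : ℕ} {r : ℝ} (hr : |r| < 1) (x y : Cube d) :
    0 < noiseKernel r x y := by
  refine Finset.prod_pos fun i _ => ?_
  have h : |r * sgn (x i * y i)| < 1 := by rwa [abs_mul, abs_sgn, mul_one]
  linarith [(abs_lt.1 h).1]

lemma sum_noiseKernel {d : ℕ} (r : ℝ) (x : Cube d) : ∑ y, noiseKernel r x y = 1 := by
  unfold noiseKernel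
  rw [sum_prod_cube fun i t => (1 + r * sgn (x i * t)) / 2]
  refine Finset.prod_eq_one fun i _ => ?_
  simp only [map_mul, map_one, sgn_neg_one]
  ring

/-- The kernel is a product measure, so all factors but the `i`-th integrate to 1: degree-one
characters have eigenvalue `r`. -/
lemma sum_noiseKernel_mul_sgn {d : ℕ} (r : ℝ) (x : Cube d) (i : Fin d) :
    ∑ y, noiseKernel r x y * sgn (x i * y i) = r := by
  have h : ∀ y : Cube d, noiseKernel r x y * sgn (x i * y i) =
      ∏ j, ((1 + r * sgn (x j * y j)) / 2 * if j = i then sgn (x j * y j) else 1) := by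
    intro y
    rw [Finset.prod_mul_distrib, Finset.prod_ite_eq' Finset.univ i fun j => sgn (x j * y j)]
    simp [noiseKernel]
  simp only [h]
  rw [sum_prod_cube fun j t =>
    (1 + r * sgn (x j * t)) / 2 * if j = i then sgn (x j * t) else 1]
  rw [Finset.prod_eq_single i]
  · simp only [if_true, map_mul, map_one, sgn_neg_one]
    linear_combination r * sgn_mul_self (x i)
  · intro j _ hj
    simp only [if_neg hj, map_mul, map_one, sgn_neg_one]
    ring
  · simp

lemma sum_noiseKernel_mul_noiseKernel {d : ℕ} (r s : ℝ) (x y : Cube d) :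
    ∑ u, noiseKernel r x u * noiseKernel s u y = noiseKernel (r * s) x y := by
  simp only [noiseKernel, ← Finset.prod_mul_distrib]
  rw [sum_prod_cube fun i t => (1 + r * sgn (x i * t)) / 2 * ((1 + s * sgn (t * y i)) / 2)]
  refine Finset.prod_congr rfl fun i _ => ?_
  simp only [map_mul, map_one, sgn_neg_one]
  ring

lemma noise_noise {d : ℕ} (r s : ℝ) (f : Cube d → ℝ) (x : Cube d) :
    noise r (noise s f) x = noise (r * s) f x := by
  simp only [noise, ← sum_noiseKernel_mul_noiseKernel, Finset.mul_sum, Finset.sum_mul]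
  rw [Finset.sum_comm]
  exact Finset.sum_congr rfl fun _ _ => Finset.sum_congr rfl fun _ _ => by ring

lemma sum_mul_noise {d : ℕ} (r : ℝ) (f g : Cube d → ℝ) :
    ∑ x, f x * noise r g x = ∑ x, noise r f x * g x := by
  simp only [noise, Finset.mul_sum, Finset.sum_mul]
  rw [Finset.sum_comm]
  exact Finset.sum_congr rfl fun x _ => Finset.sum_congr rfl fun y _ => by
    rw [noiseKernel_comm]; ring

/-- A density bounded by `k ≤ e^m` on the cube has bounded noise stability. -/
lemma sum_noise_sq_le {d m : ℕ} (hm : 1 ≤ m) {r : ℝ} (hr : r ^ 2 * (2 * m) ≤ 1) {k : ℝ}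
    (hk : k ≤ Real.exp m) {F : Cube d → ℝ} (h0 : ∀ x, 0 ≤ F x) (hF : ∀ x, F x ≤ k)
    (h1 : ∑ x, F x = 2 ^ d) :
    ∑ x, noise r F x ^ 2 ≤ 2 ^ d * Real.exp 1 := by
  set A := (∑ x, noise r F x ^ 2) / 2 ^ d with hA
  have hA0 : 0 ≤ A := by positivity
  have hk0 : 0 ≤ k := (h0 1).trans (hF 1)
  have hself : A = ∑ x, F x / 2 ^ d * noise r (noise r F) x := by
    rw [hA, Finset.sum_div]
    simp only [div_mul_eq_mul_div]
    rw [← Finset.sum_div, ← Finset.sum_div, sum_mul_noise]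
    simp only [sq]
  -- Jensen for the probability weights `F / 2^d`, then `F ≤ k`, then hypercontractivity applied to
  -- `T_r F`, whose mean square is `A`.
  have hle : A ^ m * A ^ m ≤ k * A ^ m := by
    calc A ^ m * A ^ m = (∑ x, F x / 2 ^ d * noise r (noise r F) x) ^ (2 * m) := by
          rw [← hself]; ring
      _ ≤ ∑ x, F x / 2 ^ d * noise r (noise r F) x ^ (2 * m) :=
          Real.pow_arith_mean_le_arith_mean_pow_of_even _ _ _
            (fun x _ => div_nonneg (h0 x) (by positivity))
            (by rw [← Finset.sum_div, h1, div_self (by positivity)]) (even_two_mul m)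
      _ ≤ ∑ x, k / 2 ^ d * noise r (noise r F) x ^ (2 * m) := by
          refine Finset.sum_le_sum fun x _ => ?_
          refine mul_le_mul_of_nonneg_right ?_ ((even_two_mul m).pow_nonneg _)
          gcongr
          exact hF x
      _ ≤ k / 2 ^ d * (2 ^ d * A ^ m) := by
          rw [← Finset.mul_sum]
          gcongr
          exact hypercontractivity hm hr _
      _ = k * A ^ m := by field_simp
  have hAe : A ≤ Real.exp 1 := by
    rcases hA0.eq_or_lt with h | h
    · rw [← h]; positivity
    · have h2 : A ^ m ≤ Real.exp 1 ^ m := by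
        rw [← Real.exp_nat_mul, mul_one]
        exact (le_of_mul_le_mul_right hle (by positivity)).trans hk
      exact le_of_pow_le_pow_left₀ (by omega) (by positivity) h2
  have : ∑ x, noise r F x ^ 2 = 2 ^ d * A := by rw [hA]; field_simp
  rw [this]
  gcongr

/-! ### The functional and its classical value -/

/-- The coefficients of the Khot–Vishnoi functional: the questions range over the points of the
cube, and on question `u` the answer `a` stands for the point `u * h a`. -/
noncomputable def bellTable {N k : ℕ} (h : Fin k → Cube k) (e : Fin N ≃ Cube k) (ρ : ℝ) :
    Table N k :=
  fun x y a b => noiseKernel ρ (e x * h a) (e y * h b)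

/-- The density on the cube of the answers of a strategy. -/
noncomputable def answerDensity {N k : ℕ} (h : Fin k → Cube k) (e : Fin N ≃ Cube k)
    (p : Fin N → Fin k → ℝ) (u : Cube k) : ℝ :=
  ∑ a, p (e.symm (u * (h a)⁻¹)) a

/-- For each fixed answer `a`, translation by `h a` permutes the cube. -/
lemma sum_strategy {N k : ℕ} (h : Fin k → Cube k) (e : Fin N ≃ Cube k)
    (p : Fin N → Fin k → ℝ) (φ : Cube k → ℝ) :
    ∑ x, ∑ a, φ (e x * h a) * p x a = ∑ u, φ u * answerDensity h e p u := by
  simp only [answerDensity, Finset.mul_sum]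
  rw [Finset.sum_comm, Finset.sum_comm (s := Finset.univ (α := Cube k))]
  refine Finset.sum_congr rfl fun a _ => ?_
  rw [← (e.trans (Equiv.mulRight (h a))).sum_comp]
  simp

lemma card_questions {N k : ℕ} (e : Fin N ≃ Cube k) : (N : ℝ) = 2 ^ k := by
  have : N = 2 ^ k := by simpa using Fintype.card_congr e
  exact_mod_cast this

lemma sum_answerDensity {N k : ℕ} (h : Fin k → Cube k) (e : Fin N ≃ Cube k)
    {p : Fin N → Fin k → ℝ} (hp : ∀ x, ∑ a, p x a = 1) :
    ∑ u, answerDensity h e p u = 2 ^ k := by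
  have := sum_strategy h e p fun _ => 1
  simp only [one_mul, hp] at this
  rw [← this, ← card_questions e]
  simp

lemma sum_noise_answerDensity_sq_le {N k m : ℕ} (hm : 1 ≤ m) {r : ℝ}
    (hr : r ^ 2 * (2 * m) ≤ 1) (hk : (k : ℝ) ≤ Real.exp m) (h : Fin k → Cube k)
    (e : Fin N ≃ Cube k) {p : Fin N → Fin k → ℝ} (h0 : ∀ x a, 0 ≤ p x a)
    (h1 : ∀ x, ∑ a, p x a = 1) :
    ∑ u, noise r (answerDensity h e p) u ^ 2 ≤ 2 ^ k * Real.exp 1 := by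
  refine sum_noise_sq_le hm hr hk (fun u => Finset.sum_nonneg fun a _ => h0 _ _) (fun u => ?_)
    (sum_answerDensity h e h1)
  calc answerDensity h e p u ≤ ∑ _a : Fin k, (1 : ℝ) :=
        Finset.sum_le_sum fun a _ =>
          (Finset.single_le_sum (fun b _ => h0 _ b) (Finset.mem_univ a)).trans_eq (h1 _)
    _ = k := by simp

/-- Taking the correlation to be `r²` lets half of the noise be moved to each player, since `T_r` is
symmetric and `T_r T_r = T_{r²}`; then `2ab ≤ a² + b²`. -/
lemma pairing_bellTable_product_le {N k m : ℕ} (hm : 1 ≤ m) {r : ℝ}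
    (hr : r ^ 2 * (2 * m) ≤ 1) (hk : (k : ℝ) ≤ Real.exp m) (h : Fin k → Cube k)
    (e : Fin N ≃ Cube k) {p q : Fin N → Fin k → ℝ}
    (p0 : ∀ x a, 0 ≤ p x a) (p1 : ∀ x, ∑ a, p x a = 1)
    (q0 : ∀ x a, 0 ≤ q x a) (q1 : ∀ x, ∑ a, q x a = 1) :
    pairing (bellTable h e (r ^ 2)) (fun x y a b => p x a * q y b) ≤ 2 ^ k * Real.exp 1 := by
  set F := answerDensity h e p
  set G := answerDensity h e q
  have key : pairing (bellTable h e (r ^ 2)) (fun x y a b => p x a * q y b) =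
      ∑ u, noise r F u * noise r G u := by
    calc pairing (bellTable h e (r ^ 2)) (fun x y a b => p x a * q y b)
        = ∑ x, ∑ a, (∑ y, ∑ b, noiseKernel (r ^ 2) (e x * h a) (e y * h b) * q y b) * p x a := by
          simp only [pairing, bellTable]
          refine Finset.sum_congr rfl fun x _ => ?_
          rw [Finset.sum_comm]
          refine Finset.sum_congr rfl fun a _ => ?_
          simp only [Finset.sum_mul]
          exact Finset.sum_congr rfl fun y _ => Finset.sum_congr rfl fun b _ => by ring
      _ = ∑ x, ∑ a, noise (r ^ 2) G (e x * h a) * p x a := by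
          refine Finset.sum_congr rfl fun x _ => Finset.sum_congr rfl fun a _ => ?_
          rw [sum_strategy h e q fun v => noiseKernel (r ^ 2) (e x * h a) v]
          rfl
      _ = ∑ u, noise r F u * noise r G u := by
          rw [sum_strategy h e p, ← sum_mul_noise r F (noise r G)]
          refine Finset.sum_congr rfl fun u _ => ?_
          rw [noise_noise, sq, mul_comm]
  rw [key]
  have hF := sum_noise_answerDensity_sq_le hm hr hk h e p0 p1
  have hG := sum_noise_answerDensity_sq_le hm hr hk h e q0 q1
  calc ∑ u, noise r F u * noise r G u
      ≤ ∑ u, (noise r F u ^ 2 + noise r G u ^ 2) / 2 :=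
        Finset.sum_le_sum fun u _ => by nlinarith [sq_nonneg (noise r F u - noise r G u)]
    _ = (∑ u, noise r F u ^ 2 + ∑ u, noise r G u ^ 2) / 2 := by
        rw [← Finset.sum_div, Finset.sum_add_distrib]
    _ ≤ _ := by linarith

lemma pairing_eq_integral {N K : ℕ} (M : Table N K) {Ω : Type} [MeasurableSpace Ω]
    (μ : MeasureTheory.Measure Ω) {f : Ω → Table N K}
    (hf : ∀ x y a b, MeasureTheory.Integrable (fun ω => f ω x y a b) μ) :
    pairing M (fun x y a b => ∫ ω, f ω x y a b ∂μ) = ∫ ω, pairing M (f ω) ∂μ := by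
  have i4 := fun x y a b => (hf x y a b).const_mul (M x y a b)
  have i3 := fun x y a => MeasureTheory.integrable_finsetSum Finset.univ fun b _ => i4 x y a b
  have i2 := fun x y => MeasureTheory.integrable_finsetSum Finset.univ fun a _ => i3 x y a
  have i1 := fun x => MeasureTheory.integrable_finsetSum Finset.univ fun y _ => i2 x y
  unfold pairing
  rw [MeasureTheory.integral_finsetSum _ fun x _ => i1 x]
  refine Finset.sum_congr rfl fun x _ => ?_
  rw [MeasureTheory.integral_finsetSum _ fun y _ => i2 x y]
  refine Finset.sum_congr rfl fun y _ => ?_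
  rw [MeasureTheory.integral_finsetSum _ fun a _ => i3 x y a]
  refine Finset.sum_congr rfl fun a _ => ?_
  rw [MeasureTheory.integral_finsetSum _ fun b _ => i4 x y a b]
  refine Finset.sum_congr rfl fun b _ => ?_
  rw [MeasureTheory.integral_const_mul]

lemma bellTable_pos {N k : ℕ} (h : Fin k → Cube k) (e : Fin N ≃ Cube k) {ρ : ℝ} (hρ : |ρ| < 1)
    (x y : Fin N) (a b : Fin k) : 0 < bellTable h e ρ x y a b :=
  noiseKernel_pos hρ _ _

/-- A classical distribution is an average of product ones; positivity of the coefficients removes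
the absolute value. -/
lemma classicalValue_bellTable_le {N k m : ℕ} (hm : 1 ≤ m) {r : ℝ}
    (hr : r ^ 2 * (2 * m) ≤ 1) (hr1 : |r ^ 2| < 1) (hk : (k : ℝ) ≤ Real.exp m)
    (h : Fin k → Cube k) (e : Fin N ≃ Cube k) :
    classicalValue (bellTable h e (r ^ 2)) ≤ ENNReal.ofReal (2 ^ k * Real.exp 1) := by
  refine iSup₂_le fun P hP => ENNReal.ofReal_le_ofReal ?_
  obtain ⟨Ω, _, μ, p, q, hμ, pm, qm, p0, p1, q0, q1, hP⟩ := hP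
  have le1 : ∀ {f : Ω → Fin N → Fin k → ℝ}, (∀ ω x a, 0 ≤ f ω x a) →
      (∀ ω x, ∑ a, f ω x a = 1) → ∀ ω x a, f ω x a ≤ 1 := fun f0 f1 ω x a =>
    (Finset.single_le_sum (fun b _ => f0 ω x b) (Finset.mem_univ a)).trans_eq (f1 ω x)
  have hint : ∀ x y a b, MeasureTheory.Integrable (fun ω => p ω x a * q ω y b) μ := by
    intro x y a b
    refine MeasureTheory.Integrable.of_bound
      ((pm x a).mul (qm y b)).aestronglyMeasurable 1 (Filter.Eventually.of_forall fun ω => ?_)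
    rw [Real.norm_of_nonneg (mul_nonneg (p0 _ _ _) (q0 _ _ _))]
    exact mul_le_one₀ (le1 p0 p1 _ _ _) (q0 _ _ _) (le1 q0 q1 _ _ _)
  have hPeq : P = fun x y a b => ∫ ω, p ω x a * q ω y b ∂μ := by
    funext x y a b
    exact hP x y a b
  have hnonneg : ∀ ω, 0 ≤ pairing (bellTable h e (r ^ 2)) fun x y a b => p ω x a * q ω y b :=
    fun ω => Finset.sum_nonneg fun x _ => Finset.sum_nonneg fun y _ =>
      Finset.sum_nonneg fun a _ => Finset.sum_nonneg fun b _ =>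
        mul_nonneg (bellTable_pos h e hr1 x y a b).le (mul_nonneg (p0 _ _ _) (q0 _ _ _))
  rw [hPeq, pairing_eq_integral _ μ (f := fun ω x y a b => p ω x a * q ω y b) hint,
    abs_of_nonneg (MeasureTheory.integral_nonneg hnonneg)]
  refine (MeasureTheory.integral_mono_of_nonneg (Filter.Eventually.of_forall hnonneg)
    (MeasureTheory.integrable_const (2 ^ k * Real.exp 1))
    (Filter.Eventually.of_forall fun ω =>
      pairing_bellTable_product_le hm hr hk h e (p0 ω) (p1 ω) (q0 ω) (q1 ω))).trans_eq ?_
  simp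

lemma isBellInequality_bellTable {N k : ℕ} (hk : 0 < k) (h : Fin k → Cube k)
    (e : Fin N ≃ Cube k) {ρ : ℝ} (hρ : |ρ| < 1) : IsBellInequality (bellTable h e ρ) := by
  have hk' : (0 : ℝ) < k := by exact_mod_cast hk
  have hk0 := hk'.ne'
  have : Nonempty (Fin k) := ⟨⟨0, hk⟩⟩
  have : Nonempty (Fin N) := ⟨e.symm 1⟩
  -- Uniform answers over a one-point space; all coefficients are positive.
  refine ⟨fun _ _ _ _ => (k : ℝ)⁻¹ * (k : ℝ)⁻¹, ⟨Unit, inferInstance, MeasureTheory.Measure.dirac (),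
    fun _ _ _ => (k : ℝ)⁻¹, fun _ _ _ => (k : ℝ)⁻¹, inferInstance, fun _ _ => measurable_const,
    fun _ _ => measurable_const, fun _ _ _ => by positivity, fun _ _ => by simp [hk0],
    fun _ _ _ => by positivity, fun _ _ => by simp [hk0], fun _ _ _ _ => by simp⟩, ne_of_gt ?_⟩
  refine Finset.sum_pos (fun x _ => Finset.sum_pos (fun y _ => Finset.sum_pos (fun a _ =>
    Finset.sum_pos (fun b _ => mul_pos (bellTable_pos h e hρ x y a b) (by positivity)) ?_) ?_) ?_) ?_
  all_goals exact Finset.univ_nonempty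

/-! ### Hadamard signs and the quantum strategy -/

lemma exists_isHadamard_two_pow (l : ℕ) :
    ∃ H : Matrix (Fin (2 ^ l)) (Fin (2 ^ l)) ℤ, H.IsHadamard := by
  induction l with
  | zero =>
    refine ⟨1, fun i j => ?_, ?_, ?_⟩
    · rw [show i = j from Subsingleton.elim (α := Fin 1) i j, Matrix.one_apply_eq]
      exact one_mem _
    · simp
    · simp
  | succ l ih =>
    obtain ⟨H, hH⟩ := ih
    have h2 : (!![1, 1; 1, -1] : Matrix (Fin 2) (Fin 2) ℤ).IsHadamard := by
      refine ⟨fun i j => ?_, ?_, ?_⟩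
      · rw [Unitary.mem_iff_eq_one_or_eq_neg_one]
        fin_cases i <;> fin_cases j <;> simp
      · ext i j
        fin_cases i <;> fin_cases j <;> simp [Matrix.mul_apply, Fin.sum_univ_two]
      · ext i j
        fin_cases i <;> fin_cases j <;> simp [Matrix.mul_apply, Fin.sum_univ_two]
    exact ⟨_, (hH.kronecker h2).reindex finProdFinEquiv finProdFinEquiv⟩

lemma exists_orthogonal_signs (l : ℕ) :
    ∃ h : Fin (2 ^ l) → Cube (2 ^ l), ∀ i j,
      ∑ a, sgn (h a i) * sgn (h a j) = if i = j then ((2 ^ l : ℕ) : ℝ) else 0 := by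
  obtain ⟨H, hH⟩ := exists_isHadamard_two_pow l
  refine ⟨fun a i => Unitary.toUnits ⟨H a i, hH.apply_mem a i⟩, fun i j => ?_⟩
  have h := congr_fun (congr_fun hH.conjTranspose_mul i) j
  have h' : ∑ a, H a i * H a j = if i = j then ((2 ^ l : ℕ) : ℤ) else 0 := by
    simpa [Matrix.mul_apply, Matrix.one_apply] using h
  have h'' := congr_arg (fun z : ℤ => (z : ℝ)) h'
  push_cast at h''
  simpa [sgn] using h''

/-- The vector of `ℝⁿ` with the given signs as its first `k` coordinates, and zeros after them. -/
def signVector {k : ℕ} (n : ℕ) (s : Cube k) (i : Fin n) : ℝ :=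
  if h : (i : ℕ) < k then sgn (s ⟨i, h⟩) else 0

/-- The indicator of the coordinates from the `k`-th on. -/
def tailIndicator (k n : ℕ) (i : Fin n) : ℝ := if (i : ℕ) < k then 0 else 1

/-- The real matrix `k⁻¹ (v vᵀ + 1_{≥ k})`, where `v` is the sign vector of `s`. -/
noncomputable def realEffect {k : ℕ} (n : ℕ) (s : Cube k) : Matrix (Fin n) (Fin n) ℝ :=
  (k : ℝ)⁻¹ • (Matrix.vecMulVec (signVector n s) (signVector n s) +
    Matrix.diagonal (tailIndicator k n))

/-- The effect `k⁻¹ (v vᵀ + 1_{≥ k})` on `ℂⁿ`. -/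
noncomputable def effect {k : ℕ} (n : ℕ) (s : Cube k) : Matrix (Fin n) (Fin n) ℂ :=
  (realEffect n s).map Complex.ofReal

lemma posSemidef_effect {k n : ℕ} (s : Cube k) : (effect n s).PosSemidef := by
  have h : effect n s = (k : ℂ)⁻¹ •
      (Matrix.vecMulVec (fun i => (signVector n s i : ℂ)) (star fun i => (signVector n s i : ℂ)) +
        Matrix.diagonal fun i => (tailIndicator k n i : ℂ)) := by
    ext i j
    by_cases hij : i = j <;>
      simp [effect, realEffect, Matrix.vecMulVec_apply, hij, mul_add]
  rw [h]
  refine ((Matrix.posSemidef_vecMulVec_self_star _).add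
    (Matrix.PosSemidef.diagonal fun i => ?_)).smul ?_
  · simp only [Pi.zero_apply, tailIndicator]
    split_ifs <;> simp
  · rw [← Complex.ofReal_natCast, ← Complex.ofReal_inv, Complex.zero_le_real]
    positivity

/-- Column orthogonality makes the rank-one parts sum to the identity on the first `k` coordinates,
the signs `s` entering only as `sᵢ² = 1`; the `k` tail terms supply the rest. -/
lemma sum_effect {k n : ℕ} (hk : 0 < k) {h : Fin k → Cube k}
    (hh : ∀ i j, ∑ a, sgn (h a i) * sgn (h a j) = if i = j then (k : ℝ) else 0) (s : Cube k) :
    ∑ a, effect n (s * h a) = 1 := by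
  have hk' : (k : ℝ) ≠ 0 := by exact_mod_cast hk.ne'
  have hreal : ∑ a, realEffect n (s * h a) = 1 := by
    ext i j
    simp only [Matrix.sum_apply, realEffect, Matrix.smul_apply, Matrix.add_apply,
      Matrix.vecMulVec_apply, smul_eq_mul, ← Finset.mul_sum, Finset.sum_add_distrib,
      Finset.sum_const, Finset.card_univ, Fintype.card_fin, nsmul_eq_mul]
    rw [inv_mul_eq_iff_eq_mul₀ hk']
    by_cases hi : (i : ℕ) < k
    · have hd : Matrix.diagonal (tailIndicator k n) i j = 0 := by
        rw [Matrix.diagonal_apply]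
        split_ifs <;> simp [tailIndicator, hi]
      rw [hd, mul_zero, add_zero]
      by_cases hj : (j : ℕ) < k
      · have e : ∀ a, signVector n (s * h a) i * signVector n (s * h a) j =
            sgn (s ⟨i, hi⟩) * sgn (s ⟨j, hj⟩) * (sgn (h a ⟨i, hi⟩) * sgn (h a ⟨j, hj⟩)) := by
          intro a
          simp only [signVector, hi, hj, dif_pos, Pi.mul_apply, map_mul]
          ring
        simp only [e, ← Finset.mul_sum, hh]
        rcases eq_or_ne i j with rfl | hij
        · simp [sgn_mul_self]
        · have : (⟨i, hi⟩ : Fin k) ≠ ⟨j, hj⟩ := fun hc => hij (Fin.ext (Fin.mk.inj_iff.1 hc))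
          simp [this, hij]
      · have hij : i ≠ j := fun hc => hj (hc ▸ hi)
        simp [signVector, hj, hij]
    · simp [signVector, hi, Matrix.diagonal_apply, Matrix.one_apply, tailIndicator]
  ext i j
  have hij : ∑ a, realEffect n (s * h a) i j = (1 : Matrix (Fin n) (Fin n) ℝ) i j := by
    rw [← hreal, Matrix.sum_apply]
  simp only [Matrix.sum_apply, effect, Matrix.map_apply, ← Complex.ofReal_sum, hij,
    Matrix.one_apply]
  split_ifs <;> simp

lemma trace_kronecker_mul_pureState {n : ℕ} (A B : Matrix (Fin n) (Fin n) ℝ) (α : Fin n → ℝ) :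
    ((A.map Complex.ofReal ⊗ₖ B.map Complex.ofReal) * pureState (diagonalVector α)).trace =
      ((∑ i, ∑ j, α i * α j * (A i j * B i j) : ℝ) : ℂ) := by
  rw [pureState, Matrix.mul_vecMulVec, Matrix.trace_vecMulVec]
  simp only [dotProduct, Matrix.mulVec, Fintype.sum_prod_type, diagonalVector,
    Matrix.kroneckerMap_apply, Matrix.map_apply, Pi.star_apply, mul_ite, mul_zero,
    Finset.sum_ite_eq, Finset.mem_univ, if_true, apply_ite star, star_zero]
  push_cast
  refine Finset.sum_congr rfl fun i _ => ?_
  rw [Finset.sum_mul]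
  refine Finset.sum_congr rfl fun j _ => ?_
  simp
  ring

/-- Sign vectors vanish on the tail, so there are no cross terms, and the rank-one part factors into
a square. -/
lemma sum_realEffect {k n : ℕ} (s t : Cube k) (α : Fin n → ℝ) :
    ∑ i, ∑ j, α i * α j * (realEffect n s i j * realEffect n t i j) =
      (k : ℝ)⁻¹ ^ 2 * ((∑ i, α i * (signVector n s i * signVector n t i)) ^ 2 +
        ∑ i, α i ^ 2 * tailIndicator k n i) := by
  have e : ∀ i j, α i * α j * (realEffect n s i j * realEffect n t i j) =
      (k : ℝ)⁻¹ ^ 2 * ((α i * (signVector n s i * signVector n t i)) *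
        (α j * (signVector n s j * signVector n t j)) +
          if i = j then α i ^ 2 * tailIndicator k n i else 0) := by
    intro i j
    simp only [realEffect, Matrix.smul_apply, Matrix.add_apply, Matrix.vecMulVec_apply,
      smul_eq_mul, Matrix.diagonal_apply]
    rcases eq_or_ne i j with rfl | hij
    · by_cases hi : (i : ℕ) < k
      · simp only [tailIndicator, hi, if_true]
        ring
      · simp only [tailIndicator, signVector, hi, if_true, if_false, dif_neg, not_false_eq_true]
        ring
    · simp only [hij, if_false]
      ring
  simp only [e, ← Finset.mul_sum, Finset.sum_add_distrib, Finset.sum_ite_eq, Finset.mem_univ,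
    if_true, sq, Finset.sum_mul_sum]

lemma sum_mul_signVector {k n : ℕ} (hkn : k ≤ n) (s t : Cube k) (α : Fin n → ℝ) :
    ∑ i, α i * (signVector n s i * signVector n t i) =
      ∑ i, α (Fin.castLE hkn i) * sgn (s i * t i) := by
  symm
  refine Finset.sum_of_injOn (Fin.castLE hkn) (Fin.castLE_injective hkn).injOn (by simp)
    (fun i _ hi => ?_) fun i _ => ?_
  · have : ¬ (i : ℕ) < k := fun h => hi ⟨⟨i, h⟩, by simp, rfl⟩
    simp [signVector, this]
  · simp [signVector, map_mul]

lemma sum_sum_cube_mul {N k : ℕ} (h : Fin k → Cube k) (e : Fin N ≃ Cube k) (φ : Cube k → ℝ) :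
    ∑ x, ∑ a, φ (e x * h a) = k * ∑ u, φ u := by
  have := sum_strategy h e (fun _ _ => 1) φ
  simpa [answerDensity, ← Finset.sum_mul, mul_comm] using this

lemma sq_sum_le_sum_noiseKernel_mul_sq {k : ℕ} {ρ : ℝ} (hρ : |ρ| < 1) (β : Fin k → ℝ)
    (u : Cube k) :
    (ρ * ∑ i, β i) ^ 2 ≤ ∑ v, noiseKernel ρ u v * (∑ i, β i * sgn (u i * v i)) ^ 2 := by
  have h : ρ * ∑ i, β i = ∑ v, noiseKernel ρ u v * ∑ i, β i * sgn (u i * v i) := by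
    simp only [Finset.mul_sum]
    rw [Finset.sum_comm]
    refine Finset.sum_congr rfl fun i _ => ?_
    simp only [mul_left_comm _ (β i)]
    rw [← Finset.mul_sum, sum_noiseKernel_mul_sgn, mul_comm]
  rw [h]
  exact Real.pow_arith_mean_le_arith_mean_pow_of_even _ _ _
    (fun v _ => (noiseKernel_pos hρ u v).le) (sum_noiseKernel ρ u) even_two

/-- Each pair of cube points is named by `k²` choices of questions and answers, cancelling the `k⁻²`
of the effects. The nonnegative tail term is dropped. -/
lemma le_quantumValue_bellTable {N k n : ℕ} (hk : 0 < k) (hkn : k ≤ n) {h : Fin k → Cube k}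
    (hh : ∀ i j, ∑ a, sgn (h a i) * sgn (h a j) = if i = j then (k : ℝ) else 0)
    (e : Fin N ≃ Cube k) {ρ : ℝ} (hρ : |ρ| < 1) (α : Fin n → ℝ) :
    ENNReal.ofReal (2 ^ k * (ρ * ∑ i, α (Fin.castLE hkn i)) ^ 2) ≤
      quantumValue (pureState (diagonalVector α)) (bellTable h e ρ) := by
  set P : Table N k := fun x y a b =>
    ∑ i, ∑ j, α i * α j * (realEffect n (e x * h a) i j * realEffect n (e y * h b) i j) with hP
  have hQ : IsQuantum (pureState (diagonalVector α)) P :=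
    ⟨fun x a => effect n (e x * h a), fun y b => effect n (e y * h b),
      ⟨fun _ _ => posSemidef_effect _, fun _ => sum_effect hk hh _⟩,
      ⟨fun _ _ => posSemidef_effect _, fun _ => sum_effect hk hh _⟩,
      fun x y a b => (trace_kronecker_mul_pureState _ _ _).symm⟩
  refine le_trans (ENNReal.ofReal_le_ofReal ?_) (le_iSup₂ (f := fun Q _ =>
    ENNReal.ofReal |pairing (bellTable h e ρ) Q|) P hQ)
  refine le_trans ?_ (le_abs_self _)
  have hk0 : (k : ℝ) ≠ 0 := by exact_mod_cast hk.ne'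
  set β : Fin k → ℝ := fun i => α (Fin.castLE hkn i)
  set Φ : Cube k → Cube k → ℝ := fun u v =>
    noiseKernel ρ u v * (∑ i, β i * sgn (u i * v i)) ^ 2
  calc (2 : ℝ) ^ k * (ρ * ∑ i, β i) ^ 2 = ∑ _u : Cube k, (ρ * ∑ i, β i) ^ 2 := by simp
    _ ≤ ∑ u, ∑ v, Φ u v :=
        Finset.sum_le_sum fun u _ => sq_sum_le_sum_noiseKernel_mul_sq hρ β u
    _ = (k : ℝ)⁻¹ ^ 2 * ∑ x, ∑ a, ∑ y, ∑ b, Φ (e x * h a) (e y * h b) := by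
        simp only [fun u => sum_sum_cube_mul h e (Φ u)]
        rw [sum_sum_cube_mul h e fun u => k * ∑ v, Φ u v, ← Finset.mul_sum]
        field_simp
    _ = ∑ x, ∑ y, ∑ a, ∑ b, (k : ℝ)⁻¹ ^ 2 * Φ (e x * h a) (e y * h b) := by
        simp only [Finset.mul_sum]
        exact Finset.sum_congr rfl fun x _ => Finset.sum_comm
    _ ≤ pairing (bellTable h e ρ) P := by
        refine Finset.sum_le_sum fun x _ => Finset.sum_le_sum fun y _ =>
          Finset.sum_le_sum fun a _ => Finset.sum_le_sum fun b _ => ?_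
        simp only [hP, sum_realEffect, sum_mul_signVector hkn]
        rw [show (k : ℝ)⁻¹ ^ 2 * Φ (e x * h a) (e y * h b) = bellTable h e ρ x y a b *
          ((k : ℝ)⁻¹ ^ 2 * (∑ i, β i * sgn ((e x * h a) i * (e y * h b) i)) ^ 2) by
            simp only [Φ, bellTable]; ring]
        refine mul_le_mul_of_nonneg_left (mul_le_mul_of_nonneg_left ?_ (by positivity))
          (bellTable_pos h e hρ x y a b).le
        refine le_add_of_nonneg_right (Finset.sum_nonneg fun i _ => mul_nonneg (sq_nonneg _) ?_)
        rw [tailIndicator]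
        split_ifs <;> norm_num

/-! ### The violation and the choice of parameters -/

/-- The violation obtained from the Khot–Vishnoi functional of a Hadamard matrix of order `k`. -/
lemma le_largestViolation_of_orthogonal_signs {n k m : ℕ} (hk : 0 < k) (hm : 1 ≤ m)
    (hkm : (k : ℝ) ≤ Real.exp m) (hkn : k ≤ n) {h : Fin k → Cube k}
    (hh : ∀ i j, ∑ a, sgn (h a i) * sgn (h a j) = if i = j then (k : ℝ) else 0) (α : Fin n → ℝ) :
    ENNReal.ofReal (((∑ i, α (Fin.castLE hkn i)) / (2 * m)) ^ 2 / Real.exp 1) ≤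
      largestViolation (pureState (diagonalVector α)) := by
  have hm' : (1 : ℝ) ≤ m := by exact_mod_cast hm
  -- The largest correlation that the hypercontractive bound allows.
  set r := √(1 / (2 * m) : ℝ)
  have hr2 : r ^ 2 = 1 / (2 * m) := Real.sq_sqrt (by positivity)
  have hr : r ^ 2 * (2 * m) ≤ 1 := by
    rw [hr2]; field_simp; exact le_rfl
  have hr1 : |r ^ 2| < 1 := by
    rw [hr2, abs_of_pos (by positivity), div_lt_one (by positivity)]
    linarith
  set e := (Fintype.equivFin (Cube k)).symm
  have hc := classicalValue_bellTable_le hm hr hr1 hkm h e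
  have hq := le_quantumValue_bellTable hk hkn hh e hr1 α
  have hB := isBellInequality_bellTable hk h e hr1
  calc ENNReal.ofReal (((∑ i, α (Fin.castLE hkn i)) / (2 * m)) ^ 2 / Real.exp 1)
      = ENNReal.ofReal (2 ^ k * (r ^ 2 * ∑ i, α (Fin.castLE hkn i)) ^ 2) /
          ENNReal.ofReal (2 ^ k * Real.exp 1) := by
        rw [← ENNReal.ofReal_div_of_pos (by positivity), hr2]
        congr 1
        field_simp
    _ ≤ _ := ENNReal.div_le_div hq hc
    _ ≤ _ := by
        refine le_iSup_of_le _ (le_iSup_of_le k (le_iSup_of_le (bellTable h e (r ^ 2)) ?_))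
        rw [iSup_pos hB]

lemma sum_filter_lt_le {n k k' : ℕ} (hkn : k ≤ n) (hk' : k' ≤ n) (hk : k ≤ 2 * k')
    {α : Fin n → ℝ} (h0 : ∀ i, 0 < α i) (hα : Antitone α) :
    ∑ i ∈ Finset.univ.filter (fun i : Fin n => (i : ℕ) < k), α i ≤
      2 * ∑ i, α (Fin.castLE hk' i) := by
  -- Extension by zero keeps monotonicity and allows indices up to `2 * k'`, which may exceed `n`.
  set a : ℕ → ℝ := fun i => if h : i < n then α ⟨i, h⟩ else 0 with ha
  have a0 : ∀ i, 0 ≤ a i := by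
    intro i
    simp only [ha]
    split_ifs
    · exact (h0 _).le
    · exact le_rfl
  have amono : ∀ i j, i ≤ j → a j ≤ a i := by
    intro i j hij
    by_cases hj : j < n
    · simp only [ha, hj, hij.trans_lt hj, dif_pos]
      exact hα (by simpa using hij)
    · simpa [ha, hj] using a0 i
  have e1 : ∑ i ∈ Finset.univ.filter (fun i : Fin n => (i : ℕ) < k), α i =
      ∑ i ∈ Finset.range k, a i := by
    refine Finset.sum_bij (fun i _ => (i : ℕ)) (by simp) (fun _ _ _ _ h => Fin.ext h)
      (fun j hj => ?_) (by simp [ha])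
    have hj' : j < k := by simpa using hj
    exact ⟨⟨j, hj'.trans_le hkn⟩, by simpa using hj', rfl⟩
  have e2 : ∑ i, α (Fin.castLE hk' i) = ∑ i ∈ Finset.range k', a i := by
    rw [← Fin.sum_univ_eq_sum_range]
    refine Finset.sum_congr rfl fun i _ => ?_
    simp only [ha, i.2.trans_le hk', dif_pos]
    rfl
  rw [e1, e2]
  calc ∑ i ∈ Finset.range k, a i ≤ ∑ i ∈ Finset.range (k' + k'), a i :=
        Finset.sum_le_sum_of_subset_of_nonneg
          (Finset.range_mono (by omega)) fun i _ _ => a0 i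
    _ = ∑ i ∈ Finset.range k', a i + ∑ i ∈ Finset.range k', a (k' + i) :=
        Finset.sum_range_add _ _ _
    _ ≤ ∑ i ∈ Finset.range k', a i + ∑ i ∈ Finset.range k', a i := by
        gcongr with i _
        exact amono _ _ (by omega)
    _ = _ := by ring

end BellViolation

theorem mainTheorem6 :
    ∃ C : ℝ, 0 < C ∧
      ∀ (n : ℕ) (α : Fin n → ℝ), (∀ i, 0 < α i) → Antitone α → ∑ i, α i ^ 2 = 1 →
        (⨆ k ∈ Finset.Icc 2 n,
            ENNReal.ofReal
              (C * ((∑ i ∈ Finset.univ.filter (fun i : Fin n => (i : ℕ) < k), α i) / Real.log (k : ℝ)) ^ 2)) ≤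
          BellViolation.largestViolation
            (BellViolation.pureState (BellViolation.diagonalVector α)) := by
  -- `144 = (2 · 2 · 3)²`: rounding `k` to a power of two, the 2 in `r² = 1/(2m)`, and `m ≤ 3 log
  -- k`. The factor `e` is the classical bound.
  refine ⟨1 / (144 * Real.exp 1), by positivity, fun n α h0 hα _ => iSup₂_le fun k hk => ?_⟩
  obtain ⟨hk2, hkn⟩ := Finset.mem_Icc.1 hk
  have hlk : 2 ^ Nat.log 2 k ≤ k := Nat.pow_log_le_self 2 (by omega)
  have hkl : k < 2 ^ (Nat.log 2 k + 1) := Nat.lt_pow_succ_log_self (by norm_num) k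
  rw [pow_succ] at hkl
  have hlogk : Real.log 2 ≤ Real.log k := Real.log_le_log (by norm_num) (by exact_mod_cast hk2)
  have hlog : 0.6931471803 < Real.log k := Real.log_two_gt_d9.trans_le hlogk
  have hk0 : (0 : ℝ) < k := by positivity
  have hm : 1 ≤ ⌈Real.log k⌉₊ := Nat.one_le_ceil_iff.2 (by linarith)
  -- The `+ 1` of the ceiling is absorbed because `log k ≥ log 2 > 1/2`.
  have hm3 : (⌈Real.log k⌉₊ : ℝ) ≤ 3 * Real.log k := by
    have := Nat.ceil_lt_add_one (a := Real.log k) (by linarith)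
    linarith
  have hexp : ((2 ^ Nat.log 2 k : ℕ) : ℝ) ≤ Real.exp ⌈Real.log k⌉₊ := by
    calc ((2 ^ Nat.log 2 k : ℕ) : ℝ) ≤ k := by exact_mod_cast hlk
      _ = Real.exp (Real.log k) := (Real.exp_log hk0).symm
      _ ≤ _ := Real.exp_le_exp.2 (Nat.le_ceil _)
  obtain ⟨h, hh⟩ := BellViolation.exists_orthogonal_signs (Nat.log 2 k)
  refine le_trans (ENNReal.ofReal_le_ofReal ?_)
    (BellViolation.le_largestViolation_of_orthogonal_signs (by positivity) hm hexp
      (hlk.trans hkn) hh α)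
  have hS := BellViolation.sum_filter_lt_le hkn (hlk.trans hkn) (by omega) h0 hα
  have hm1 : (1 : ℝ) ≤ ⌈Real.log k⌉₊ := by exact_mod_cast hm
  have hS0 : 0 ≤ ∑ i ∈ Finset.univ.filter (fun i : Fin n => (i : ℕ) < k), α i :=
    Finset.sum_nonneg fun i _ => (h0 i).le
  set S := ∑ i ∈ Finset.univ.filter (fun i : Fin n => (i : ℕ) < k), α i
  set T := ∑ i, α (Fin.castLE (hlk.trans hkn) i)
  have hST : S / Real.log k / 12 ≤ T / (2 * ⌈Real.log k⌉₊) := by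
    calc S / Real.log k / 12 = (S / 2) / (2 * (3 * Real.log k)) := by
          ring
      _ ≤ T / (2 * ⌈Real.log k⌉₊) := by
          apply div_le_div₀ <;> linarith
  calc 1 / (144 * Real.exp 1) * (S / Real.log k) ^ 2
      = (S / Real.log k / 12) ^ 2 / Real.exp 1 := by
        field_simp
        ring
    _ ≤ (T / (2 * ⌈Real.log k⌉₊)) ^ 2 / Real.exp 1 := by
        have : 0 ≤ S / Real.log k / 12 := by positivity
        gcongr
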